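/- Let $K$ be a (not necessarily commutative) field, i.e. a division ring, with centre $Z$, and let $U$ be a left vector space over $K$ of finite or infinite dimension greater than $1$. Let $R=\operatorname{End}_K(U)$ be its endomorphism ring, where endomorphisms are written on the right of their arguments, so that a product $\alpha\beta$ means first $\alpha$, then $\beta$; embed $Z$ in $R$ by $a\mapsto a\cdot\mathrm{id}_U$. For a ring $S$ with $1$, let $GL(2,S)$ act from the right on the free left module $S^2$ of row vectors and on its submodules. The projective line $\mathbb{P}(S)$ is the $GL(2,S)$-orbit of the submodule $S(1,0)$. Points $p,q\in\mathbb{P}(S)$ are called distant if the pair $(p,q)$ lies in the $GL(2,S)$-orbit of the pair $(S(1,0),S(0,1))$; the distant graph on $\mathbb{P}(S)$ has vertex set $\mathbb{P}(S)$, its edges being the $2$-sets of distant points. Via $Z(a,b)\mapsto R(a,b)$ the projective line $\mathbb{P}(Z)$ is regarded as a subset of $\mathbb{P}(R)$; the images of this subset under $GL(2,R)$ are the $Z$-chains, and the chain geometry $\Sigma(Z,R)$ consists of the point set $\mathbb{P}(R)$ together with all $Z$-chains. Then the automorphisms of the distant graph on $\mathbb{P}(R)$ are precisely the automorphisms of the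 chain geometry $\Sigma(Z,R)$. That is, a permutation $\sigma$ of $\mathbb{P}(R)$ preserves adjacency in the distant graph in both directions if, and only if, it preserves $Z$-chains in both directions (for every $C\subseteq\mathbb{P}(R)$, the set $\sigma(C)$ is a $Z$-chain if and only if $C$ is one). -/

import Mathlib

namespace ChainGeometry

/-- The group `GL(2, S)` of invertible `2 × 2` matrices over a (not necessarily commutative)
ring `S`. -/
abbrev GL2 (S : Type*) [Ring S] : Type _ := (Matrix (Fin 2) (Fin 2) S)ˣ

/-- The action of `g ∈ GL(2, S)` on the submodules of the free left module `S²` of row vectors,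
induced by `x ↦ x * g`. -/
def moveSubmodule {S : Type*} [Ring S] (g : GL2 S) (p : Submodule S (Fin 2 → S)) :
    Submodule S (Fin 2 → S) :=
  p.map (Matrix.vecMulLinear (g : Matrix (Fin 2) (Fin 2) S))

/-- The cyclic submodule `S(a, b)` of the left module `S²`. -/
def cyclic {S : Type*} [Ring S] (a b : S) : Submodule S (Fin 2 → S) :=
  Submodule.span S {![a, b]}

/-- The projective line over `S`: the orbit of `S(1, 0)` under `GL(2, S)`. -/
def projLine (S : Type*) [Ring S] : Set (Submodule S (Fin 2 → S)) :=
  {p | ∃ g : GL2 S, p = moveSubmodule g (cyclic 1 0)}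

theorem moveSubmodule_mul {S : Type*} [Ring S] (g h : GL2 S)
    (p : Submodule S (Fin 2 → S)) :
    moveSubmodule (g * h) p = moveSubmodule h (moveSubmodule g p) := by
  unfold moveSubmodule
  rw [← Submodule.map_comp]
  congr 1
  refine LinearMap.ext fun v => ?_
  simp [Matrix.vecMul_vecMul]

theorem moveSubmodule_cyclic {S : Type*} [Ring S] (g : GL2 S) (a b : S) :
    moveSubmodule g (cyclic a b) =
      cyclic (a * g.1 0 0 + b * g.1 1 0) (a * g.1 0 1 + b * g.1 1 1) := by
  unfold moveSubmodule cyclic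
  rw [Submodule.map_span, Set.image_singleton]
  congr 2
  ext i
  fin_cases i <;> simp [Matrix.vecMul, dotProduct, Fin.sum_univ_two]

/-- The action of `GL(2, S)` on the points of the projective line. -/
def movePoint {S : Type*} [Ring S] (g : GL2 S) (p : projLine S) : projLine S :=
  ⟨moveSubmodule g p.1, by
    obtain ⟨h, hh⟩ := p.2
    exact ⟨h * g, by rw [hh, moveSubmodule_mul]⟩⟩

/-- The matrix that interchanges the two coordinates. -/
def swapMatrix (S : Type*) [Ring S] : GL2 S :=
  ⟨!![0, 1; 1, 0], !![0, 1; 1, 0],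
    by simp [Matrix.one_fin_two],
    by simp [Matrix.one_fin_two]⟩

/-- Two points are distant if they form a pair in the `GL(2, S)`-orbit of the pair
`(S(1, 0), S(0, 1))`. -/
def Distant {S : Type*} [Ring S] (p q : projLine S) : Prop :=
  ∃ g : GL2 S, p.1 = moveSubmodule g (cyclic 1 0) ∧ q.1 = moveSubmodule g (cyclic 0 1)

theorem Distant.symm {S : Type*} [Ring S] {p q : projLine S} (h : Distant p q) :
    Distant q p := by
  obtain ⟨g, hp, hq⟩ := h
  refine ⟨swapMatrix S * g, ?_, ?_⟩
  · rw [hq, moveSubmodule_mul, moveSubmodule_cyclic (swapMatrix S)]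
    simp [swapMatrix]
  · rw [hp, moveSubmodule_mul, moveSubmodule_cyclic (swapMatrix S)]
    simp [swapMatrix]

/-- The distant graph: the edges are the `2`-sets of distant points. -/
def distantGraph (S : Type*) [Ring S] : SimpleGraph (projLine S) where
  Adj p q := p ≠ q ∧ Distant p q
  symm := ⟨fun _ _ h => ⟨h.1.symm, h.2.symm⟩⟩
  loopless := ⟨fun _ h => h.1 rfl⟩

/-- The image of the projective line over `F` in the projective line over `S` under
`F(a, b) ↦ S(a, b)`, where `F` is embedded in `S` by `φ`. -/
def standardChain {F S : Type*} [Ring F] [Ring S] (φ : F →+* S) : Set (projLine S) :=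
  {p | ∃ a b : F, cyclic a b ∈ projLine F ∧ p.1 = cyclic (φ a) (φ b)}

/-- The set of `F`-chains: the `GL(2, S)`-orbit of the standard chain. -/
def chains {F S : Type*} [Ring F] [Ring S] (φ : F →+* S) : Set (Set (projLine S)) :=
  {C | ∃ g : GL2 S, C = movePoint g '' standardChain φ}

/-- The submodule `S(a, b)` is a point of the projective line over `S` whenever `F(a, b)` is one
of the projective line over `F`; so `standardChain` contains all of these submodules. -/
theorem cyclic_map_mem_projLine {F S : Type*} [Ring F] [Ring S] (φ : F →+* S) {a b : F}
    (h : cyclic a b ∈ projLine F) : cyclic (φ a) (φ b) ∈ projLine S := by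
  obtain ⟨g, hg⟩ := h
  refine ⟨Units.map φ.mapMatrix.toMonoidHom g, ?_⟩
  rw [moveSubmodule_cyclic] at hg ⊢
  have key : ∀ {a b c d : F}, cyclic a b ≤ cyclic c d →
      cyclic (φ a) (φ b) ≤ cyclic (φ c) (φ d) := by
    intro a b c d hle
    have h1 : ![a, b] ∈ cyclic c d := hle (Submodule.mem_span_singleton_self _)
    obtain ⟨r, hr⟩ := Submodule.mem_span_singleton.1 h1
    have h2 : r * c = a := by simpa using congrFun hr 0
    have h3 : r * d = b := by simpa using congrFun hr 1
    unfold cyclic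
    rw [Submodule.span_singleton_le_iff_mem, Submodule.mem_span_singleton]
    exact ⟨φ r, by simp [← h2, ← h3]⟩
  have := le_antisymm (key hg.le) (key hg.ge)
  simpa using this

/-- The endomorphism ring of a left vector space, with endomorphisms written on the right of their
arguments: the product `α * β` means first `α`, then `β`. -/
abbrev EndRight (K U : Type*) [DivisionRing K] [AddCommGroup U] [Module K U] : Type _ :=
  (Module.End K U)ᵐᵒᵖ

/-- The embedding `a ↦ a • id` of the centre `Z` of `K` in the endomorphism ring of `U`. -/
def centerEmbedding (K U : Type*) [DivisionRing K] [AddCommGroup U] [Module K U] :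
    Subring.center K →+* EndRight K U where
  toFun a := MulOpposite.op
    { toFun := fun u => (a : K) • u
      map_add' := smul_add _
      map_smul' := fun k u => by
        simp only [RingHom.id_apply, smul_smul]
        rw [Subring.mem_center_iff.1 a.2 k] }
  map_one' := by
    apply MulOpposite.unop_injective; ext u; simp
  map_mul' a b := by
    apply MulOpposite.unop_injective; ext u
    simp [smul_smul, Subring.mem_center_iff.1 b.2 (a : K)]
  map_zero' := by
    apply MulOpposite.unop_injective; ext u; simp
  map_add' a b := by
    apply MulOpposite.unop_injective; ext u; simp [add_smul]

/-- A permutation of the points is an automorphism of the distant graph if it preserves adjacency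
in both directions. -/
def IsDistantAut {S : Type*} [Ring S] (σ : Equiv.Perm (projLine S)) : Prop :=
  ∀ p q, (distantGraph S).Adj (σ p) (σ q) ↔ (distantGraph S).Adj p q

/-- A permutation of the points is an automorphism of the chain geometry if it preserves chains in
both directions. -/
def IsChainAut {F S : Type*} [Ring F] [Ring S] (φ : F →+* S)
    (σ : Equiv.Perm (projLine S)) : Prop :=
  ∀ C : Set (projLine S), σ '' C ∈ chains φ ↔ C ∈ chains φ

/-
Let `R` be the endomorphism ring of `U`. The point `R(a, b)` corresponds to the subspace
`{(u a, u b) | u ∈ U}` of `U × U`; distant points correspond to complementary subspaces, `R(0, 1)`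
to `0 × U` and `R(1, f)` to the graph of `f`.

Distinct points are distant if and only if some chain contains them both, so an automorphism of the
chain geometry is one of the distant graph. For the converse, chains have to be recovered from the
distant relation. By complementarity one recognizes which subspaces are adjacent (each of them a
hyperplane of their sum) and which triples of subspaces lie in a pencil. For graphs this singles
out the endomorphisms of rank one, by adjacency to the graph of `0`, and tells when two of them
have the same kernel and image. Hence one recognizes the `f ∈ GL(U)` such that for every rank one
`a` having a nonzero fixed vector there is some `b`, with the same kernel and image as `a`, for
which `b - f` is not invertible. A central scalar `f` has this property, with `b = f a`. If `f`
sends some `v` out of the line `K v`, the property fails for an `a` that fixes `v f` and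
annihilates `v`: a vector on which `f` agrees with `b` would be a multiple of `v`, hence zero.
Finally, an endomorphism that leaves every line invariant is a central scalar, as the dimension
exceeds one. So the standard chain is determined by its points `∞`, `0`, `1` and the distant
relation, and `GL(2, R)` is transitive on triples of pairwise distant points.
-/

section Relation

variable {P Q : Type*}

/-- Three distinct elements `c`, `a`, `b` such that all that is related to `c` is related to `a`
or to `b`. For the relation of complementarity of subspaces, this says that they are adjacent
members of a pencil. -/
def InPencil (D : P → P → Prop) (c a b : P) : Prop :=
  c ≠ a ∧ c ≠ b ∧ a ≠ b ∧ ∀ x, D x c → D x a ∨ D x b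

/-- The `Z`-chain through `A`, `B`, `W`, expressed by the distant relation `D` alone.

With `A = ∞`, `B = 0` and `W = 1`, the points `α` are the endomorphisms of rank one that fix a
nonzero vector, the points `β` are those with the same kernel and image as `α`, and the condition
on `X = f` is that some such `β` agrees with `f` at a vector which `f` sends into the image. -/
def relChain (D : P → P → Prop) (A B W : P) : Set P :=
  {X | X = A ∨ X = B ∨ D X A ∧ D X B ∧ ∀ α, (∃ γ, InPencil D B α γ) → D α A → ¬ D α W →
    ∃ β, (β = α ∨ InPencil D B α β) ∧ D β A ∧ ¬ D β X}

variable {D : P → P → Prop} {E : Q → Q → Prop}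

theorem InPencil.symm {c a b : P} (h : InPencil D c a b) : InPencil D c b a :=
  ⟨h.2.1, h.1, h.2.2.1.symm, fun x hx => (h.2.2.2 x hx).symm⟩

theorem inPencil_relIso_iff (σ : D ≃r E) {c a b : P} :
    InPencil E (σ c) (σ a) (σ b) ↔ InPencil D c a b := by
  simp only [InPencil, σ.injective.ne_iff, σ.surjective.forall, σ.map_rel_iff]

theorem image_relChain (σ : D ≃r E) (A B W : P) :
    σ '' relChain D A B W = relChain E (σ A) (σ B) (σ W) := by
  ext X
  obtain ⟨X, rfl⟩ := σ.surjective X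
  simp only [relChain, σ.injective.mem_set_image, Set.mem_ofPred_eq, σ.surjective.forall,
    σ.surjective.exists, σ.injective.eq_iff, σ.map_rel_iff, inPencil_relIso_iff]

end Relation

section Lattice

variable {L : Type*} [Lattice L] [BoundedOrder L]

/-- Two elements of a lattice are adjacent if their join covers both of them. -/
def Adjacent (c a : L) : Prop :=
  c ⋖ c ⊔ a ∧ a ⋖ c ⊔ a

theorem InPencil.toDual {c a b : L} (h : InPencil IsCompl c a b) :
    InPencil (P := Lᵒᵈ) IsCompl (.toDual c) (.toDual a) (.toDual b) :=
  ⟨h.1, h.2.1, h.2.2.1, fun x hx =>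
    (h.2.2.2 (OrderDual.ofDual x) hx.ofDual).imp (fun hxa => hxa.dual) fun hxb => hxb.dual⟩

variable [IsModularLattice L]

theorem not_lt_of_isCompl {x a c : L} (ha : IsCompl x a) (hc : IsCompl x c) : ¬ a < c := by
  intro h
  refine h.ne (eq_of_le_of_inf_le_of_sup_le (z := x) h.le ?_ ?_)
  · rw [hc.symm.inf_eq_bot]
    exact bot_le
  · rw [ha.symm.sup_eq_top]
    exact le_top

theorem isAtom_inf_iff_covBy {x c q : L} (hx : IsCompl x c) (hcq : c ≤ q) :
    IsAtom (x ⊓ q) ↔ c ⋖ q := by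
  have hinf : c ⊓ (x ⊓ q) = ⊥ := by rw [← inf_assoc, hx.symm.inf_eq_bot, bot_inf_eq]
  have hsup : c ⊔ x ⊓ q = q := by
    rw [← sup_inf_assoc_of_le x hcq, hx.symm.sup_eq_top, top_inf_eq]
  rw [← bot_covBy_iff, ← hinf]
  constructor
  · intro h
    simpa only [hsup] using covBy_sup_of_inf_covBy_right h
  · intro h
    exact inf_covBy_of_covBy_sup_left (hsup.symm ▸ h)

theorem isCompl_of_covBy {x c d q : L} (hx : IsCompl x c) (hc : c ⋖ q) (hd : d ⋖ q)
    (hxd : ¬ x ⊓ q ≤ d) : IsCompl x d := by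
  have hatom : IsAtom (x ⊓ q) := (isAtom_inf_iff_covBy hx hc.le).2 hc
  constructor
  · rw [disjoint_iff, ← inf_eq_right.2 hd.le, ← inf_assoc]
    exact (hatom.not_le_iff_disjoint.1 hxd).eq_bot
  · have hq : q ≤ x ⊔ d := by
      rcases hd.eq_or_eq le_sup_right (sup_le inf_le_right hd.le) with h | h
      · exact absurd (sup_eq_right.1 h) hxd
      · exact h.ge.trans (sup_le_sup_right inf_le_left d)
    rw [codisjoint_iff_le_sup, ← hx.sup_eq_top]
    exact sup_le le_sup_left (hc.le.trans hq)

theorem covBy_sup_right_of_isCompl {x c a : L} (hc : IsCompl x c) (ha : IsCompl x a)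
    (h : c ⋖ c ⊔ a) : a ⋖ c ⊔ a :=
  (isAtom_inf_iff_covBy ha le_sup_right).1 ((isAtom_inf_iff_covBy hc le_sup_left).2 h)

theorem Adjacent.inPencil {c a b : L} (h : Adjacent c a) (hab : a ≠ b)
    (hsup : c ⊔ a = c ⊔ b) (hinf : c ⊓ a = c ⊓ b) : InPencil IsCompl c a b := by
  obtain ⟨hc, ha⟩ := h
  have hb : b ⋖ c ⊔ a :=
    hsup ▸ covBy_sup_of_inf_covBy_left (hinf ▸ inf_covBy_of_covBy_sup_right ha)
  have hle : a ⊓ b ≤ c := by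
    have hba : c ⊓ a ≤ b := hinf.trans_le inf_le_right
    rcases (inf_covBy_of_covBy_sup_left hc).eq_or_eq (le_inf inf_le_right hba) inf_le_left
      with h | h
    · exact h.trans_le inf_le_left
    · rcases ha.eq_or_eq (inf_eq_left.1 h) hb.le with h | h
      exacts [absurd h.symm hab, absurd h hb.ne]
  refine ⟨?_, ?_, hab, fun x hx => ?_⟩
  · rintro rfl
    exact hc.ne (sup_idem c).symm
  · rintro rfl
    exact hc.ne (hsup.trans (sup_idem c)).symm
  · by_cases hxa : x ⊓ (c ⊔ a) ≤ a
    · refine Or.inr (isCompl_of_covBy hx hc hb fun hxb => ?_)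
      refine ((isAtom_inf_iff_covBy hx hc.le).2 hc).1 (le_bot_iff.1 ?_)
      exact hx.disjoint inf_le_left ((le_inf hxa hxb).trans hle)
    · exact Or.inl (isCompl_of_covBy hx hc ha hxa)

variable [ComplementedLattice L] [IsAtomistic L]

theorem isCoatomistic_of_isAtomistic : IsCoatomistic L := by
  refine ⟨fun c => ⟨{m | IsCoatom m ∧ c ≤ m}, ⟨fun m hm => hm.2, fun a ha => ?_⟩, fun m hm => hm.1⟩⟩
  refine le_iff_atom_le_imp.2 fun p hp hpa => ?_
  by_contra hpc
  obtain ⟨m, hcm, hm⟩ := (hp.not_le_iff_disjoint.1 hpc).symm.exists_isCompl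
  have ham : a ≤ m := ha ⟨hm.symm.isAtom_iff_isCoatom.1 hp, hcm⟩
  exact hp.1 (le_bot_iff.1 (hm.disjoint (hpa.trans ham) le_rfl))

theorem eq_of_forall_isCompl {b c : L} (h : ∀ x, IsCompl x c → IsCompl x b) : b = c := by
  have hbc : b ≤ c := by
    refine le_iff_atom_le_imp.2 fun p hp hpb => ?_
    by_contra hpc
    obtain ⟨x, hpx, hx⟩ := (hp.not_le_iff_disjoint.1 hpc).exists_isCompl
    exact hp.1 (le_bot_iff.1 ((h x hx).disjoint hpx hpb))
  obtain ⟨x, hx⟩ := exists_isCompl c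
  exact hbc.eq_of_not_lt (not_lt_of_isCompl (h x hx.symm) hx.symm)

variable {c a b : L}

theorem InPencil.exists_isAtom_le (h : InPencil IsCompl c a b) :
    ∃ p, IsAtom p ∧ p ≤ a ∧ ¬ p ≤ c := by
  obtain ⟨hca, hcb, -, h⟩ := h
  have hac : ¬ a ≤ c := fun hac => hcb (eq_of_forall_isCompl fun x hx =>
    (h x hx).resolve_left fun hxa => not_lt_of_isCompl hxa hx (hac.lt_of_ne' hca)).symm
  simpa only [le_iff_atom_le_imp (a := a), not_forall, exists_prop] using hac

theorem InPencil.le_sup_of_isAtom (h : InPencil IsCompl c a b) {p : L} (hp : IsAtom p)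
    (hpa : p ≤ a) (hpc : ¬ p ≤ c) : b ≤ c ⊔ p := by
  refine le_iff_atom_le_imp.2 fun q hq hqb => ?_
  by_contra hqc
  have hdisj : Disjoint (p ⊔ q) c :=
    ((hp.not_le_iff_disjoint.1 hpc).symm.disjoint_sup_right_of_disjoint_sup_left
      (hq.not_le_iff_disjoint.1 hqc).symm).symm
  obtain ⟨x, hx, hxc⟩ := hdisj.exists_isCompl
  rcases h.2.2.2 x hxc with hxa | hxb
  · exact hp.1 (le_bot_iff.1 (hxa.disjoint (le_sup_left.trans hx) hpa))
  · exact hq.1 (le_bot_iff.1 (hxb.disjoint (le_sup_right.trans hx) hqb))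

theorem InPencil.exists_isAtom_sup_eq (h : InPencil IsCompl c a b) :
    ∃ p, IsAtom p ∧ ¬ p ≤ c ∧ c ⊔ a = c ⊔ p ∧ c ⊔ b = c ⊔ p := by
  obtain ⟨p, hp, hpa, hpc⟩ := h.exists_isAtom_le
  obtain ⟨q, hq, hqb, hqc⟩ := h.symm.exists_isAtom_le
  have hb : b ≤ c ⊔ p := h.le_sup_of_isAtom hp hpa hpc
  have ha : a ≤ c ⊔ q := h.symm.le_sup_of_isAtom hq hqb hqc
  have hqp : c ⊔ q ≤ c ⊔ p := sup_le le_sup_left (hqb.trans hb)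
  have hpq : c ⊔ p ≤ c ⊔ q := sup_le le_sup_left (hpa.trans ha)
  exact ⟨p, hp, hpc, le_antisymm (sup_le le_sup_left (ha.trans hqp)) (sup_le_sup_left hpa c),
    le_antisymm (sup_le le_sup_left hb) (hpq.trans (sup_le_sup_left hqb c))⟩

theorem InPencil.sup_eq (h : InPencil IsCompl c a b) : c ⊔ a = c ⊔ b := by
  obtain ⟨p, -, -, ha, hb⟩ := h.exists_isAtom_sup_eq
  exact ha.trans hb.symm

theorem InPencil.covBy_sup (h : InPencil IsCompl c a b) : c ⋖ c ⊔ a := by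
  obtain ⟨p, hp, hpc, ha, -⟩ := h.exists_isAtom_sup_eq
  rw [ha]
  refine covBy_sup_of_inf_covBy_right ?_
  rw [(hp.not_le_iff_disjoint.1 hpc).symm.eq_bot]
  exact hp.bot_covBy

theorem inPencil_isCompl_iff :
    InPencil IsCompl c a b ↔ Adjacent c a ∧ a ≠ b ∧ c ⊔ a = c ⊔ b ∧ c ⊓ a = c ⊓ b := by
  refine ⟨fun h => ?_, fun ⟨hadj, hab, hsup, hinf⟩ => hadj.inPencil hab hsup hinf⟩
  have : IsCoatomistic L := isCoatomistic_of_isAtomistic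
  have hcov : c ⊓ a ⋖ c := h.toDual.covBy_sup.ofDual
  exact ⟨⟨h.covBy_sup, covBy_sup_of_inf_covBy_left hcov⟩, h.2.2.1, h.sup_eq, h.toDual.sup_eq⟩

end Lattice

section Submodule

variable {K V : Type*} [DivisionRing K] [AddCommGroup V] [Module K V]

theorem Adjacent.exists_inPencil {c a : Submodule K V} (h : Adjacent c a) :
    ∃ b, InPencil IsCompl c a b := by
  obtain ⟨u, hua, huc⟩ := SetLike.not_le_iff_exists.1 (left_lt_sup.1 h.1.lt)
  obtain ⟨v, hvc, hva⟩ := SetLike.not_le_iff_exists.1 (right_lt_sup.1 h.2.lt)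
  have hc : u + v ∉ c := by rwa [c.add_mem_iff_left hvc]
  have ha : u + v ∉ a := by rwa [a.add_mem_iff_right hua]
  have hq : u + v ∈ c ⊔ a :=
    add_mem (Submodule.mem_sup_right hua) (Submodule.mem_sup_left hvc)
  set b := Submodule.span K {u + v} ⊔ c ⊓ a
  have hb : u + v ∈ b := Submodule.mem_sup_left (Submodule.mem_span_singleton_self _)
  have hbq : b ≤ c ⊔ a :=
    sup_le ((Submodule.span_singleton_le_iff_mem _ _).2 hq) (inf_le_left.trans le_sup_left)
  have hcov : c ⊓ a ⋖ b := Submodule.covBy_span_singleton_sup fun hi => hc hi.1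
  refine ⟨b, h.inPencil (fun hab => ha (hab ▸ hb)) ?_ ?_⟩
  · rcases h.1.eq_or_eq (le_sup_left : c ≤ c ⊔ b) (sup_le le_sup_left hbq) with h | h
    · exact absurd (sup_eq_left.1 h hb) hc
    · exact h.symm
  · rcases hcov.eq_or_eq (le_inf inf_le_left le_sup_right) (inf_le_right : c ⊓ b ≤ b) with h | h
    · exact h.symm
    · exact absurd (inf_eq_right.1 h hb) hc

end Submodule

section ProjectiveLine

variable {S : Type*} [Ring S]

theorem moveSubmodule_one (p : Submodule S (Fin 2 → S)) : moveSubmodule 1 p = p := by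
  have : Matrix.vecMulLinear ((1 : GL2 S) : Matrix (Fin 2) (Fin 2) S) = LinearMap.id :=
    LinearMap.ext fun v => Matrix.vecMul_one v
  rw [moveSubmodule, this, Submodule.map_id]

theorem movePoint_mul (g h : GL2 S) (p : projLine S) :
    movePoint (g * h) p = movePoint h (movePoint g p) :=
  Subtype.ext (moveSubmodule_mul g h p.1)

theorem Distant.movePoint {p q : projLine S} (h : Distant p q) (g : GL2 S) :
    Distant (movePoint g p) (movePoint g q) := by
  obtain ⟨k, hp, hq⟩ := h
  exact ⟨k * g, by rw [moveSubmodule_mul, ← hp]; rfl, by rw [moveSubmodule_mul, ← hq]; rfl⟩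

theorem movePoint_inv_movePoint (g : GL2 S) (p : projLine S) :
    movePoint g⁻¹ (movePoint g p) = p := by
  rw [← movePoint_mul, mul_inv_cancel]
  exact Subtype.ext (moveSubmodule_one p.1)

/-- The action of an invertible matrix on the projective line, as an automorphism of the distant
relation. -/
def moveIso (g : GL2 S) : @Distant S _ ≃r @Distant S _ where
  toFun := movePoint g
  invFun := movePoint g⁻¹
  left_inv := movePoint_inv_movePoint g
  right_inv p := by simpa only [inv_inv] using movePoint_inv_movePoint g⁻¹ p
  map_rel_iff' {p q} := by
    refine ⟨fun h => ?_, fun h => h.movePoint g⟩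
    simpa only [Equiv.coe_fn_mk, movePoint_inv_movePoint] using h.movePoint g⁻¹

theorem coe_moveIso_apply (g : GL2 S) (p : projLine S) :
    (moveIso g p : Submodule S (Fin 2 → S)) = moveSubmodule g p :=
  rfl

theorem moveIso_mul_apply (g h : GL2 S) (p : projLine S) :
    moveIso (g * h) p = moveIso h (moveIso g p) :=
  movePoint_mul g h p

theorem cyclic_eq_cyclic_iff {a b c d : S} : cyclic a b = cyclic c d ↔
    (∃ r, r * c = a ∧ r * d = b) ∧ ∃ r, r * a = c ∧ r * b = d := by
  simp only [cyclic, le_antisymm_iff, Submodule.span_singleton_le_iff_mem,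
    Submodule.mem_span_singleton, funext_iff, Fin.forall_fin_two, Pi.smul_apply, smul_eq_mul,
    Matrix.cons_val_zero, Matrix.cons_val_one]

theorem cyclic_mul_left_of_isUnit {u : S} (hu : IsUnit u) (a b : S) :
    cyclic (u * a) (u * b) = cyclic a b := by
  obtain ⟨u, rfl⟩ := hu
  exact cyclic_eq_cyclic_iff.2 ⟨⟨u, rfl, rfl⟩, ↑u⁻¹, by simp, by simp⟩

theorem cyclic_zero_zero_notMem_projLine [Nontrivial S] : cyclic (0 : S) 0 ∉ projLine S := by
  rintro ⟨g, hg⟩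
  rw [moveSubmodule_cyclic, cyclic_eq_cyclic_iff] at hg
  obtain ⟨-, r, h0, h1⟩ := hg
  have h := congrFun (congrFun (Units.mul_inv g) 0) 0
  simp only [mul_zero, one_mul, zero_mul, add_zero] at h0 h1
  rw [Matrix.mul_apply, Fin.sum_univ_two, ← h0, ← h1] at h
  simp at h

/-- The point `S(0, 1)`, which plays the role of `∞`. -/
def infPoint (S : Type*) [Ring S] : projLine S :=
  ⟨cyclic 0 1, swapMatrix S, by simp [moveSubmodule_cyclic, swapMatrix]⟩

theorem exists_moveIso_infPoint_eq (p : projLine S) : ∃ g, moveIso g (infPoint S) = p := by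
  obtain ⟨_, g, rfl⟩ := p
  have hswap : moveSubmodule (swapMatrix S) (cyclic 0 1) = cyclic 1 0 := by
    simp [moveSubmodule_cyclic, swapMatrix]
  refine ⟨swapMatrix S * g, Subtype.ext ?_⟩
  rw [coe_moveIso_apply, infPoint, moveSubmodule_mul, hswap]

/-- The matrix with rows `(1, s)` and `(0, 1)`. -/
def translation (s : S) : GL2 S :=
  ⟨!![1, s; 0, 1], !![1, -s; 0, 1], by simp [Matrix.one_fin_two], by simp [Matrix.one_fin_two]⟩

/-- The point `S(1, s)`; these are the points distant to `infPoint S`. -/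
def affinePoint (s : S) : projLine S :=
  ⟨cyclic 1 s, translation s, by simp [moveSubmodule_cyclic, translation]⟩

theorem distant_affinePoint_infPoint (s : S) : Distant (affinePoint s) (infPoint S) :=
  ⟨translation s, by simp [affinePoint, moveSubmodule_cyclic, translation],
    by simp [infPoint, moveSubmodule_cyclic, translation]⟩

theorem affinePoint_injective : Function.Injective (affinePoint : S → projLine S) := by
  intro s t h
  obtain ⟨⟨r, h1, h2⟩, -⟩ := cyclic_eq_cyclic_iff.1 (congrArg Subtype.val h)
  rw [← h2, (mul_one r).symm.trans h1, one_mul]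

theorem distant_infPoint_iff {p : projLine S} :
    Distant p (infPoint S) ↔ ∃ s, p = affinePoint s := by
  refine ⟨?_, fun ⟨s, hs⟩ => hs ▸ distant_affinePoint_infPoint s⟩
  rintro ⟨g, hp, hg⟩
  set h : Matrix (Fin 2) (Fin 2) S := (g⁻¹ : GL2 S).1
  have hgh (i j : Fin 2) : g.1 i 0 * h 0 j + g.1 i 1 * h 1 j = (1 : Matrix _ _ S) i j := by
    rw [← Units.mul_inv g, Matrix.mul_apply, Fin.sum_univ_two]
  have hhg (i j : Fin 2) : h i 0 * g.1 0 j + h i 1 * g.1 1 j = (1 : Matrix _ _ S) i j := by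
    rw [← Units.inv_mul g, Matrix.mul_apply, Fin.sum_univ_two]
  rw [moveSubmodule_cyclic] at hp hg
  simp only [one_mul, zero_mul, add_zero, zero_add] at hp hg
  obtain ⟨⟨r, -, hr⟩, r', hr', -⟩ := cyclic_eq_cyclic_iff.1 hg
  have hg10 : g.1 1 0 = 0 := by rw [← hr', mul_zero]
  have hh10 : h 1 0 = 0 := by
    have h0 : g.1 1 1 * h 1 0 = 0 := by simpa [hg10] using hgh 1 0
    rw [← one_mul (h 1 0), ← hr, mul_assoc, h0, mul_zero]
  have hmul : g.1 0 0 * h 0 0 = 1 := by simpa [hh10] using hgh 0 0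
  have hmul' : h 0 0 * g.1 0 0 = 1 := by simpa [hg10] using hhg 0 0
  have hunit : IsUnit (g.1 0 0) := ⟨⟨_, _, hmul, hmul'⟩, rfl⟩
  refine ⟨h 0 0 * g.1 0 1, Subtype.ext (hp.trans ?_)⟩
  simpa only [affinePoint, mul_one, ← mul_assoc, hmul, one_mul] using
    cyclic_mul_left_of_isUnit hunit 1 (h 0 0 * g.1 0 1)

theorem distant_affinePoint_zero_iff {s : S} :
    Distant (affinePoint s) (affinePoint 0) ↔ IsUnit s := by
  have hzero : moveIso (swapMatrix S) (affinePoint 0) = infPoint S :=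
    Subtype.ext (by
      simp [coe_moveIso_apply, moveSubmodule_cyclic, affinePoint, infPoint, swapMatrix])
  have hs : (moveIso (swapMatrix S) (affinePoint s)).1 = cyclic s 1 := by
    simp [coe_moveIso_apply, moveSubmodule_cyclic, affinePoint, swapMatrix]
  rw [← (moveIso (swapMatrix S)).map_rel_iff, hzero, distant_infPoint_iff, isUnit_iff_exists]
  refine exists_congr fun u => ?_
  rw [Subtype.ext_iff, hs, affinePoint, cyclic_eq_cyclic_iff]
  simp only [mul_one, exists_eq_left, exists_eq_right]

theorem distant_affinePoint_iff {s t : S} :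
    Distant (affinePoint s) (affinePoint t) ↔ IsUnit (s - t) := by
  have hmove (u : S) : moveIso (translation (-t)) (affinePoint u) = affinePoint (u - t) :=
    Subtype.ext (by simp [coe_moveIso_apply, moveSubmodule_cyclic, affinePoint, translation,
      neg_add_eq_sub])
  rw [← (moveIso (translation (-t))).map_rel_iff, hmove, hmove, sub_self,
    distant_affinePoint_zero_iff]

theorem Distant.exists_moveIso_eq {p q : projLine S} (h : Distant p q) :
    ∃ g : GL2 S, moveIso g (affinePoint 0) = p ∧ moveIso g (infPoint S) = q := by
  obtain ⟨g, hp, hq⟩ := h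
  exact ⟨g, Subtype.ext hp.symm, Subtype.ext hq.symm⟩

theorem Distant.ne [Nontrivial S] {p q : projLine S} (h : Distant p q) : p ≠ q := by
  obtain ⟨g, rfl, rfl⟩ := h.exists_moveIso_eq
  refine (moveIso g).injective.ne fun h0 => ?_
  obtain ⟨⟨r, hr, -⟩, -⟩ := cyclic_eq_cyclic_iff.1 (congrArg Subtype.val h0)
  rw [mul_zero] at hr
  exact zero_ne_one hr

theorem distantGraph_adj_iff [Nontrivial S] {p q : projLine S} :
    (distantGraph S).Adj p q ↔ Distant p q :=
  and_iff_right_of_imp Distant.ne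

theorem exists_moveIso_eq {A B W : projLine S} (hBA : Distant B A) (hWA : Distant W A)
    (hWB : Distant W B) : ∃ g : GL2 S, moveIso g (infPoint S) = A ∧
      moveIso g (affinePoint 0) = B ∧ moveIso g (affinePoint 1) = W := by
  obtain ⟨k, rfl, rfl⟩ := hBA.exists_moveIso_eq
  obtain ⟨W, rfl⟩ := (moveIso k).surjective W
  rw [(moveIso k).map_rel_iff] at hWA hWB
  obtain ⟨f, rfl⟩ := distant_infPoint_iff.1 hWA
  obtain ⟨f, rfl⟩ := distant_affinePoint_zero_iff.1 hWB
  let d : GL2 S := ⟨!![1, 0; 0, f], !![1, 0; 0, ↑f⁻¹],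
    by simp [Matrix.one_fin_two], by simp [Matrix.one_fin_two]⟩
  have haff (s : S) : moveIso d (affinePoint s) = affinePoint (s * f) :=
    Subtype.ext (by simp [coe_moveIso_apply, moveSubmodule_cyclic, affinePoint, d])
  have hinf : moveIso d (infPoint S) = infPoint S := by
    have := cyclic_mul_left_of_isUnit f.isUnit 0 1
    exact Subtype.ext (by
      simpa [coe_moveIso_apply, moveSubmodule_cyclic, infPoint, d] using this)
  refine ⟨d * k, ?_, ?_, ?_⟩
  · rw [moveIso_mul_apply, hinf]
  · rw [moveIso_mul_apply, haff, zero_mul]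
  · rw [moveIso_mul_apply, haff, one_mul]

end ProjectiveLine

section Chains

variable {F S : Type*} [DivisionRing F] [Ring S] {φ : F →+* S}

theorem mem_standardChain_iff {p : projLine S} :
    p ∈ standardChain φ ↔ p = infPoint S ∨ ∃ z, p = affinePoint (φ z) := by
  constructor
  · rintro ⟨a, b, hab, hp⟩
    rcases eq_or_ne a 0 with rfl | ha
    · have hb : b ≠ 0 := by
        rintro rfl
        exact cyclic_zero_zero_notMem_projLine hab
      refine Or.inl (Subtype.ext (hp.trans ?_))
      have := cyclic_mul_left_of_isUnit (hb.isUnit.map φ) 0 1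
      simpa only [infPoint, mul_zero, mul_one, map_zero] using this
    · refine Or.inr ⟨a⁻¹ * b, Subtype.ext (hp.trans ?_)⟩
      have := cyclic_mul_left_of_isUnit (ha.isUnit.map φ) 1 (φ (a⁻¹ * b))
      rwa [mul_one, ← map_mul, mul_inv_cancel_left₀ ha] at this
  · rintro (rfl | ⟨z, rfl⟩)
    · exact ⟨0, 1, (infPoint F).2, by simp [infPoint]⟩
    · exact ⟨1, z, (affinePoint z).2, by simp [affinePoint]⟩

theorem distant_of_mem_standardChain {p q : projLine S} (hp : p ∈ standardChain φ)
    (hq : q ∈ standardChain φ) (hpq : p ≠ q) : Distant p q := by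
  rcases mem_standardChain_iff.1 hp with rfl | ⟨y, rfl⟩ <;>
    rcases mem_standardChain_iff.1 hq with rfl | ⟨z, rfl⟩
  · exact absurd rfl hpq
  · exact (distant_affinePoint_infPoint _).symm
  · exact distant_affinePoint_infPoint _
  · have hyz : y - z ≠ 0 := sub_ne_zero.2 fun h => hpq (by rw [h])
    exact distant_affinePoint_iff.2 (map_sub φ y z ▸ hyz.isUnit.map φ)

theorem distantGraph_adj_iff_exists_chain (φ : F →+* S) {p q : projLine S} :
    (distantGraph S).Adj p q ↔ p ≠ q ∧ ∃ C ∈ chains φ, p ∈ C ∧ q ∈ C := by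
  refine and_congr_right fun hne => ⟨?_, ?_⟩
  · intro h
    obtain ⟨g, rfl, rfl⟩ := h.exists_moveIso_eq
    have hzero : affinePoint 0 ∈ standardChain φ :=
      mem_standardChain_iff.2 (Or.inr ⟨0, by rw [map_zero]⟩)
    have hinf : infPoint S ∈ standardChain φ := mem_standardChain_iff.2 (Or.inl rfl)
    exact ⟨_, ⟨g, rfl⟩, ⟨_, hzero, rfl⟩, ⟨_, hinf, rfl⟩⟩
  · rintro ⟨_, ⟨g, rfl⟩, ⟨p, hp, rfl⟩, ⟨q, hq, rfl⟩⟩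
    exact (distant_of_mem_standardChain hp hq fun h => hne (h ▸ rfl)).movePoint g

theorem IsChainAut.isDistantAut {σ : Equiv.Perm (projLine S)} (h : IsChainAut φ σ) :
    IsDistantAut σ := by
  intro p q
  rw [distantGraph_adj_iff_exists_chain φ, distantGraph_adj_iff_exists_chain φ,
    σ.injective.ne_iff]
  refine and_congr_right fun _ =>
    (Set.image_surjective.2 σ.surjective).exists.trans (exists_congr fun C => ?_)
  rw [h C, σ.injective.mem_set_image, σ.injective.mem_set_image]

theorem image_mem_chains
    (hφ : standardChain φ = relChain Distant (infPoint S) (affinePoint 0) (affinePoint 1))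
    (σ : @Distant S _ ≃r @Distant S _) {C : Set (projLine S)} (hC : C ∈ chains φ) :
    σ '' C ∈ chains φ := by
  obtain ⟨g, rfl⟩ := hC
  have hone : Distant (affinePoint (1 : S)) (affinePoint 0) :=
    distant_affinePoint_zero_iff.2 isUnit_one
  set τ := (moveIso g).trans σ
  obtain ⟨k, hA, hB, hW⟩ := exists_moveIso_eq
    (τ.map_rel_iff.2 (distant_affinePoint_infPoint 0))
    (τ.map_rel_iff.2 (distant_affinePoint_infPoint 1)) (τ.map_rel_iff.2 hone)
  refine ⟨k, ?_⟩
  calc σ '' (moveIso g '' standardChain φ)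
      = τ '' standardChain φ := Set.image_image _ _ _
    _ = moveIso k '' standardChain φ := by
      rw [hφ, image_relChain, image_relChain, hA, hB, hW]

theorem IsDistantAut.isChainAut [Nontrivial S]
    (hφ : standardChain φ = relChain Distant (infPoint S) (affinePoint 0) (affinePoint 1))
    {σ : Equiv.Perm (projLine S)} (h : IsDistantAut σ) : IsChainAut φ σ := by
  let σ' : @Distant S _ ≃r @Distant S _ :=
    ⟨σ, fun {p q} => by simpa only [distantGraph_adj_iff] using h p q⟩
  refine fun C => ⟨fun hC => ?_, image_mem_chains hφ σ'⟩
  exact σ.symm_image_image C ▸ image_mem_chains hφ σ'.symm hC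

end Chains

section Graph

variable {R M N : Type*} [Ring R] [AddCommGroup M] [Module R M] [AddCommGroup N] [Module R N]

theorem isCompl_range_inr_iff {X : Submodule R (M × N)} :
    IsCompl X (LinearMap.range (LinearMap.inr R M N)) ↔ ∃ f : M →ₗ[R] N, X = f.graph := by
  have hbij : IsCompl X (LinearMap.range (LinearMap.inr R M N)) ↔
      Function.Bijective ((LinearMap.fst R M N).domRestrict X) := by
    rw [LinearMap.range_inr, isCompl_iff, Function.Bijective, LinearMap.injective_domRestrict_iff,
      LinearMap.surjective_domRestrict_iff LinearMap.fst_surjective]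
  refine hbij.trans ⟨Submodule.exists_eq_graph, ?_⟩
  rintro ⟨f, rfl⟩
  refine ⟨fun x y h => Subtype.ext (Prod.ext h ?_), fun u => ⟨⟨(u, f u), rfl⟩, rfl⟩⟩
  exact x.2.trans ((congrArg f h).trans y.2.symm)

theorem graph_injective :
    Function.Injective (LinearMap.graph : (M →ₗ[R] N) → Submodule R (M × N)) := by
  intro f g h
  ext u
  exact (h ▸ rfl : (u, f u) ∈ g.graph)

theorem graph_zero_sup_graph (a : M →ₗ[R] N) :
    (0 : M →ₗ[R] N).graph ⊔ a.graph = (LinearMap.range a).comap (LinearMap.snd R M N) := by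
  refine le_antisymm (sup_le ?_ ?_) ?_
  · rintro ⟨u, _⟩ (rfl : _ = (0 : N))
    exact zero_mem (LinearMap.range a)
  · rintro ⟨u, _⟩ (rfl : _ = a u)
    exact ⟨u, rfl⟩
  · rintro ⟨u, _⟩ ⟨v, rfl⟩
    exact Submodule.mem_sup.2 ⟨(u - v, 0), rfl, (v, a v), rfl, by simp⟩

theorem graph_zero_inf_graph (a : M →ₗ[R] N) :
    (0 : M →ₗ[R] N).graph ⊓ a.graph = (LinearMap.ker a).map (LinearMap.inl R M N) := by
  refine le_antisymm ?_ ?_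
  · rintro ⟨u, _⟩ ⟨(rfl : _ = (0 : N)), h⟩
    exact ⟨u, h.symm, rfl⟩
  · rintro _ ⟨u, hu, rfl⟩
    exact ⟨rfl, hu.symm⟩

theorem graph_zero_covBy_sup_iff {a : M →ₗ[R] N} :
    (0 : M →ₗ[R] N).graph ⋖ (0 : M →ₗ[R] N).graph ⊔ a.graph ↔ IsAtom (LinearMap.range a) := by
  have hzero : (0 : M →ₗ[R] N).graph = (⊥ : Submodule R N).comap (LinearMap.snd R M N) := rfl
  have hsurj : Function.Surjective (LinearMap.snd R M N) := LinearMap.snd_surjective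
  rw [graph_zero_sup_graph, hzero, ← bot_covBy_iff]
  refine ⟨fun h => ?_, Submodule.comap_covBy_of_surjective hsurj⟩
  exact CovBy.of_image (OrderEmbedding.ofMapLEIff _ fun p q =>
    Submodule.comap_le_comap_iff_of_surjective hsurj) h

theorem adjacent_graph_zero_iff {a : M →ₗ[R] N} :
    Adjacent (0 : M →ₗ[R] N).graph a.graph ↔ IsAtom (LinearMap.range a) := by
  have hcompl (f : M →ₗ[R] N) : IsCompl (LinearMap.range (LinearMap.inr R M N)) f.graph :=
    (isCompl_range_inr_iff.2 ⟨f, rfl⟩).symm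
  rw [← graph_zero_covBy_sup_iff]
  exact ⟨fun h => h.1, fun h => ⟨h, covBy_sup_right_of_isCompl (hcompl 0) (hcompl a) h⟩⟩

end Graph

section Subspaces

variable {K U : Type*} [DivisionRing K] [AddCommGroup U] [Module K U]

/-- The linear map `u ↦ (u a, u b)` defined by a row vector `(a, b)` over the endomorphism ring. -/
def rowMap (v : Fin 2 → EndRight K U) : U →ₗ[K] U × U :=
  (v 0).unop.prod (v 1).unop

theorem rowMap_smul (r : EndRight K U) (v : Fin 2 → EndRight K U) :
    rowMap (r • v) = rowMap v ∘ₗ r.unop :=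
  rfl

/-- The linear map on `U × U` defined by a matrix over the endomorphism ring. -/
def matMap (g : Matrix (Fin 2) (Fin 2) (EndRight K U)) : U × U →ₗ[K] U × U :=
  (rowMap (g 0)).coprod (rowMap (g 1))

theorem rowMap_vecMul (v : Fin 2 → EndRight K U) (g : Matrix (Fin 2) (Fin 2) (EndRight K U)) :
    rowMap (Matrix.vecMul v g) = matMap g ∘ₗ rowMap v := by
  ext u <;> simp [rowMap, matMap, Matrix.vecMul, dotProduct, Fin.sum_univ_two]

theorem matMap_mul (g h : Matrix (Fin 2) (Fin 2) (EndRight K U)) :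
    matMap (g * h) = matMap h ∘ₗ matMap g := by
  simp only [matMap, LinearMap.comp_coprod, Matrix.mul_apply_eq_vecMul, rowMap_vecMul]

theorem matMap_one : matMap (1 : Matrix (Fin 2) (Fin 2) (EndRight K U)) = LinearMap.id := by
  ext u <;> simp [matMap, rowMap]

/-- The automorphism of `U × U` defined by an invertible matrix. -/
def glEquiv (g : GL2 (EndRight K U)) : (U × U) ≃ₗ[K] U × U :=
  LinearEquiv.ofLinearMap (matMap g.1) (matMap g⁻¹.1)
    (by rw [← matMap_mul, Units.inv_mul, matMap_one])
    (by rw [← matMap_mul, Units.mul_inv, matMap_one])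

/-- The subspace of `U × U` spanned by all `(u a, u b)` with `(a, b)` in a given submodule of `R²`,
where `R` is the endomorphism ring of `U`. -/
def subspace (p : Submodule (EndRight K U) (Fin 2 → EndRight K U)) : Submodule K (U × U) :=
  ⨆ v ∈ p, LinearMap.range (rowMap v)

theorem subspace_cyclic (a b : EndRight K U) :
    subspace (cyclic a b) = LinearMap.range (rowMap ![a, b]) := by
  refine le_antisymm (iSup₂_le fun v hv => ?_)
    (le_iSup₂_of_le _ (Submodule.mem_span_singleton_self _) le_rfl)
  obtain ⟨r, rfl⟩ := Submodule.mem_span_singleton.1 hv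
  rw [rowMap_smul]
  exact LinearMap.range_comp_le_range _ _

theorem subspace_moveSubmodule (g : GL2 (EndRight K U))
    (p : Submodule (EndRight K U) (Fin 2 → EndRight K U)) :
    subspace (moveSubmodule g p) = Submodule.orderIsoMapComap (glEquiv g) (subspace p) := by
  have h (v : Fin 2 → EndRight K U) : LinearMap.range (rowMap (Matrix.vecMul v g.1)) =
      Submodule.orderIsoMapComap (glEquiv g) (LinearMap.range (rowMap v)) := by
    rw [rowMap_vecMul, LinearMap.range_comp]
    rfl
  simp only [subspace, OrderIso.map_iSup, ← h]
  exact iSup_image (t := (p : Set (Fin 2 → EndRight K U))) (f := fun v => Matrix.vecMul v g.1)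
    (g := fun v => LinearMap.range (rowMap v))

theorem cyclic_le_cyclic_of_subspace_le {a b c d : EndRight K U}
    (h : subspace (cyclic a b) ≤ subspace (cyclic c d)) : cyclic a b ≤ cyclic c d := by
  rw [subspace_cyclic, subspace_cyclic] at h
  obtain ⟨r, hr⟩ := Module.projective_lifting_property (rowMap ![c, d]).rangeRestrict
    ((rowMap ![a, b]).codRestrict _ fun u => h ⟨u, rfl⟩) (LinearMap.surjective_rangeRestrict _)
  have hr (u : U) : rowMap ![c, d] (r u) = rowMap ![a, b] u :=
    congrArg Subtype.val (LinearMap.congr_fun hr u)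
  have h0 : .op r * c = a :=
    MulOpposite.unop_injective (LinearMap.ext fun u => congrArg Prod.fst (hr u))
  have h1 : .op r * d = b :=
    MulOpposite.unop_injective (LinearMap.ext fun u => congrArg Prod.snd (hr u))
  refine (Submodule.span_singleton_le_iff_mem _ _).2 (Submodule.mem_span_singleton.2 ⟨.op r, ?_⟩)
  simp only [Matrix.smul_cons, Matrix.smul_empty, smul_eq_mul, h0, h1]

theorem subspace_injective :
    Function.Injective fun p : projLine (EndRight K U) => subspace p.1 := by
  rintro ⟨_, g, rfl⟩ ⟨_, k, rfl⟩ h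
  simp only [moveSubmodule_cyclic] at h ⊢
  exact Subtype.ext (le_antisymm (cyclic_le_cyclic_of_subspace_le h.le)
    (cyclic_le_cyclic_of_subspace_le h.ge))

theorem subspace_affinePoint (f : EndRight K U) :
    subspace (affinePoint f).1 = f.unop.graph := by
  rw [affinePoint, subspace_cyclic, LinearMap.graph_eq_range_prod]
  rfl

theorem subspace_infPoint :
    subspace (infPoint (EndRight K U)).1 = LinearMap.range (LinearMap.inr K U U) := by
  rw [infPoint, subspace_cyclic]
  rfl

theorem Distant.isCompl {p q : projLine (EndRight K U)} (h : Distant p q) :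
    IsCompl (subspace p.1) (subspace q.1) := by
  obtain ⟨g, rfl, rfl⟩ := h.exists_moveIso_eq
  rw [coe_moveIso_apply, coe_moveIso_apply, subspace_moveSubmodule, subspace_moveSubmodule,
    ← OrderIso.isCompl_iff, subspace_affinePoint, subspace_infPoint]
  exact isCompl_range_inr_iff.2 ⟨0, rfl⟩

theorem exists_distant_of_isCompl {p : projLine (EndRight K U)} {X : Submodule K (U × U)}
    (h : IsCompl X (subspace p.1)) : ∃ q, Distant q p ∧ subspace q.1 = X := by
  obtain ⟨g, rfl⟩ := exists_moveIso_infPoint_eq p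
  obtain ⟨X, rfl⟩ := (Submodule.orderIsoMapComap (glEquiv g)).surjective X
  rw [coe_moveIso_apply, subspace_moveSubmodule, ← OrderIso.isCompl_iff, subspace_infPoint,
    isCompl_range_inr_iff] at h
  obtain ⟨f, rfl⟩ := h
  refine ⟨moveIso g (affinePoint (.op f)),
    (moveIso g).map_rel_iff.2 (distant_affinePoint_infPoint _), ?_⟩
  rw [coe_moveIso_apply, subspace_moveSubmodule, subspace_affinePoint, MulOpposite.unop_op]

theorem distant_iff_isCompl {p q : projLine (EndRight K U)} :
    Distant p q ↔ IsCompl (subspace p.1) (subspace q.1) := by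
  refine ⟨Distant.isCompl, fun h => ?_⟩
  obtain ⟨p', hd, hp'⟩ := exists_distant_of_isCompl h
  exact subspace_injective hp' ▸ hd

theorem inPencil_distant_iff {c a b : projLine (EndRight K U)} :
    InPencil Distant c a b ↔ InPencil IsCompl (subspace c.1) (subspace a.1) (subspace b.1) := by
  simp only [InPencil, subspace_injective.ne_iff, distant_iff_isCompl]
  refine and_congr_right fun _ => and_congr_right fun _ => and_congr_right fun _ =>
    ⟨fun h X hX => ?_, fun h x => h _⟩
  obtain ⟨x, -, rfl⟩ := exists_distant_of_isCompl hX
  exact h x hX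

end Subspaces

section Pencils

variable {K U : Type*} [DivisionRing K] [AddCommGroup U] [Module K U]

theorem InPencil.exists_subspace_eq {c a : projLine (EndRight K U)} {Y : Submodule K (U × U)}
    (h : InPencil IsCompl (subspace c.1) (subspace a.1) Y) :
    ∃ b : projLine (EndRight K U), subspace b.1 = Y := by
  obtain ⟨X, hXc, hXa⟩ : ∃ X, IsCompl X (subspace c.1) ∧ ¬ IsCompl X (subspace a.1) := by
    by_contra! hX
    exact h.1 (eq_of_forall_isCompl hX).symm
  obtain ⟨q, -, rfl⟩ := exists_distant_of_isCompl hXc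
  obtain ⟨b, -, hb⟩ := exists_distant_of_isCompl ((h.2.2.2 _ hXc).resolve_left hXa).symm
  exact ⟨b, hb⟩

theorem exists_inPencil_distant_iff {c a : projLine (EndRight K U)} :
    (∃ b, InPencil Distant c a b) ↔ Adjacent (subspace c.1) (subspace a.1) := by
  simp only [inPencil_distant_iff]
  refine ⟨fun ⟨b, h⟩ => (inPencil_isCompl_iff.1 h).1, fun h => ?_⟩
  obtain ⟨Y, hY⟩ := h.exists_inPencil
  obtain ⟨b, rfl⟩ := hY.exists_subspace_eq
  exact ⟨b, hY⟩

theorem exists_inPencil_affinePoint_iff {a : EndRight K U} :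
    (∃ γ, InPencil Distant (affinePoint 0) (affinePoint a) γ) ↔
      IsAtom (LinearMap.range a.unop) := by
  rw [exists_inPencil_distant_iff, subspace_affinePoint, subspace_affinePoint,
    ← adjacent_graph_zero_iff, MulOpposite.unop_zero]

theorem inPencil_affinePoint_iff {a b : EndRight K U} :
    InPencil Distant (affinePoint 0) (affinePoint a) (affinePoint b) ↔
      IsAtom (LinearMap.range a.unop) ∧ a ≠ b ∧
        LinearMap.range a.unop = LinearMap.range b.unop ∧
        LinearMap.ker a.unop = LinearMap.ker b.unop := by
  rw [inPencil_distant_iff, inPencil_isCompl_iff]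
  simp only [subspace_affinePoint, MulOpposite.unop_zero, adjacent_graph_zero_iff,
    graph_zero_sup_graph, graph_zero_inf_graph, graph_injective.ne_iff,
    MulOpposite.unop_injective.ne_iff,
    (Submodule.comap_injective_of_surjective LinearMap.snd_surjective).eq_iff,
    (Submodule.map_injective_of_injective LinearMap.inl_injective).eq_iff]

end Pencils

section Endomorphisms

variable {K U : Type*} [DivisionRing K] [AddCommGroup U] [Module K U] {a b f : Module.End K U}

theorem isUnit_sub_of_finite_range (hf : IsUnit f) [Module.Finite K (LinearMap.range b)]
    (h : ∀ u, b u = f u → u = 0) : IsUnit (b - f) := by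
  obtain ⟨f, rfl⟩ := hf
  have hinv (u : U) : f.1 (f.2 u) = u := LinearMap.congr_fun f.mul_inv u
  let g : LinearMap.range b →ₗ[K] LinearMap.range b :=
    (b * f.2 - 1).restrict fun w hw => sub_mem (LinearMap.mem_range_self b _) hw
  have hg : Function.Injective g := by
    refine (injective_iff_map_eq_zero g).2 fun w hw => Subtype.ext ?_
    have hw : b (f.2 w) = f.1 (f.2 w) :=
      (sub_eq_zero.1 (congrArg Subtype.val hw)).trans (hinv w).symm
    rw [← hinv w, h _ hw, map_zero, ZeroMemClass.coe_zero]
  rw [Module.End.isUnit_iff]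
  refine ⟨(injective_iff_map_eq_zero _).2 fun u hu => h u (sub_eq_zero.1 hu), fun y => ?_⟩
  obtain ⟨w, hw⟩ := LinearMap.injective_iff_surjective.1 hg ⟨b (f.2 y), f.2 y, rfl⟩
  have hw : b (f.2 w) - w = b (f.2 y) := congrArg Subtype.val hw
  refine ⟨f.2 (w - y), ?_⟩
  rw [LinearMap.sub_apply, hinv, map_sub, map_sub, ← hw]
  abel

theorem isUnit_sub_iff_of_isAtom_range (hf : IsUnit f) (hb : IsAtom (LinearMap.range b)) :
    IsUnit (b - f) ↔ ∀ u, b u = f u → u = 0 := by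
  have : IsSimpleModule K (LinearMap.range b) := isSimpleModule_iff_isAtom.2 hb
  refine ⟨fun h u hu => ?_, isUnit_sub_of_finite_range hf⟩
  exact ((Module.End.isUnit_iff _).1 h).1 (by rw [LinearMap.sub_apply, hu, sub_self, map_zero])

theorem exists_not_isUnit_sub_of_commute (hf : IsUnit f) (hfa : Commute f a)
    (ha : IsAtom (LinearMap.range a)) (ha1 : ¬ IsUnit (a - 1)) :
    ∃ b : Module.End K U, LinearMap.range b = LinearMap.range a ∧
      LinearMap.ker b = LinearMap.ker a ∧ ¬ IsUnit (b - f) := by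
  have hbij := (Module.End.isUnit_iff f).1 hf
  have hrange : LinearMap.range (f * a) = LinearMap.range a := by
    rw [hfa.eq]
    exact LinearMap.range_comp_of_range_eq_top a (LinearMap.range_eq_top.2 hbij.2)
  refine ⟨f * a, hrange, LinearMap.ker_comp_of_ker_eq_bot a (LinearMap.ker_eq_bot.2 hbij.1), ?_⟩
  rw [isUnit_sub_iff_of_isAtom_range hf (hrange ▸ ha)]
  rw [isUnit_sub_iff_of_isAtom_range isUnit_one ha] at ha1
  exact fun h => ha1 fun u hu => h u (congrArg f hu)

theorem exists_isUnit_sub_of_notMem_span (hf : IsUnit f) {v : U}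
    (hv : f v ∉ Submodule.span K {v}) :
    ∃ a : Module.End K U, IsAtom (LinearMap.range a) ∧ ¬ IsUnit (a - 1) ∧
      ∀ b : Module.End K U, LinearMap.range b = LinearMap.range a →
        LinearMap.ker b = LinearMap.ker a → IsUnit (b - f) := by
  obtain ⟨l, hl, hlf⟩ :=
    LinearMap.exists_extend_of_notMem (0 : Submodule.span K {v} →ₗ[K] K) hv 1
  have hlv : l v = 0 :=
    LinearMap.congr_fun hl ⟨v, Submodule.mem_span_singleton_self v⟩
  have hfv : f v ≠ 0 := fun h0 => hv (h0 ▸ zero_mem _)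
  set a : Module.End K U := l.smulRight (f v)
  have hrange : LinearMap.range a = Submodule.span K {f v} :=
    LinearMap.range_smulRight_apply (fun h0 => by simp [h0] at hlf) (f v)
  have ha : IsAtom (LinearMap.range a) := hrange ▸ nonzero_span_atom _ hfv
  refine ⟨a, ha, ?_, fun b hba hker => ?_⟩
  · rw [isUnit_sub_iff_of_isAtom_range isUnit_one ha]
    exact fun h => hfv (h (f v) (by simp [a, hlf]))
  · rw [isUnit_sub_iff_of_isAtom_range hf (hba ▸ ha)]
    intro u hu
    have hfu : f u ∈ Submodule.span K {f v} := hrange ▸ hba ▸ hu ▸ LinearMap.mem_range_self b u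
    obtain ⟨c, hc⟩ := Submodule.mem_span_singleton.1 hfu
    have hinj := ((Module.End.isUnit_iff f).1 hf).1
    obtain rfl : c • v = u := hinj ((map_smul f c v).trans hc)
    have hbv : v ∈ LinearMap.ker b := by simp [hker, a, hlv]
    refine hinj ?_
    rw [← hu, map_smul, LinearMap.mem_ker.1 hbv, smul_zero, map_zero]

end Endomorphisms

section Chain

variable {K U : Type*} [DivisionRing K] [AddCommGroup U] [Module K U]

theorem affinePoint_mem_relChain_iff [Nontrivial U] {f : EndRight K U} :
    affinePoint f ∈ relChain Distant (infPoint _) (affinePoint 0) (affinePoint 1) ↔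
      f = 0 ∨ IsUnit f ∧ ∀ a : EndRight K U, IsAtom (LinearMap.range a.unop) → ¬ IsUnit (a - 1) →
        ∃ b : EndRight K U, LinearMap.range b.unop = LinearMap.range a.unop ∧
          LinearMap.ker b.unop = LinearMap.ker a.unop ∧ ¬ IsUnit (b - f) := by
  have hinf (s : EndRight K U) : affinePoint s ≠ infPoint _ := (distant_affinePoint_infPoint s).ne
  have hpencil {a b : EndRight K U} (ha : IsAtom (LinearMap.range a.unop)) :
      affinePoint b = affinePoint a ∨
        InPencil Distant (affinePoint 0) (affinePoint a) (affinePoint b) ↔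
      LinearMap.range b.unop = LinearMap.range a.unop ∧
        LinearMap.ker b.unop = LinearMap.ker a.unop := by
    rw [affinePoint_injective.eq_iff, inPencil_affinePoint_iff]
    rcases eq_or_ne b a with rfl | hne
    · simp
    · simp [ha, hne, hne.symm, eq_comm]
  simp only [relChain, Set.mem_ofPred_eq, hinf, affinePoint_injective.eq_iff, false_or,
    distant_affinePoint_infPoint, true_and, distant_affinePoint_zero_iff]
  refine or_congr_right (and_congr_right fun _ => ⟨fun h a ha ha1 => ?_, fun h α hα hαA hαW => ?_⟩)
  · obtain ⟨β, hβ, hβA, hβX⟩ := h (affinePoint a) (exists_inPencil_affinePoint_iff.2 ha)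
      (distant_affinePoint_infPoint a) (distant_affinePoint_iff.not.2 ha1)
    obtain ⟨b, rfl⟩ := distant_infPoint_iff.1 hβA
    obtain ⟨hrange, hker⟩ := (hpencil ha).1 hβ
    exact ⟨b, hrange, hker, distant_affinePoint_iff.not.1 hβX⟩
  · obtain ⟨a, rfl⟩ := distant_infPoint_iff.1 hαA
    have ha := exists_inPencil_affinePoint_iff.1 hα
    obtain ⟨b, hrange, hker, hb⟩ := h a ha (distant_affinePoint_iff.not.1 hαW)
    exact ⟨affinePoint b, (hpencil ha).2 ⟨hrange, hker⟩, distant_affinePoint_infPoint b,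
      distant_affinePoint_iff.not.2 hb⟩

theorem exists_eq_centerEmbedding_of_forall_mem_span (hU : 1 < Module.rank K U)
    {f : EndRight K U} (h : ∀ v, f.unop v ∈ Submodule.span K {v}) :
    ∃ z, f = centerEmbedding K U z := by
  have hrank : Module.finrank K U ≠ 1 := fun h1 =>
    hU.ne' (Module.rank_eq_one_iff_finrank_eq_one.2 h1)
  obtain ⟨z, hz⟩ := LinearMap.exists_mem_center_apply_eq_smul_of_forall_notLinearIndependent
    (f := f.unop) hrank fun v hv => by
      obtain ⟨k, hk⟩ := Submodule.mem_span_singleton.1 (h v)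
      exact (LinearIndependent.pair_iff' (hv.ne_zero 0)).1 hv k hk
  exact ⟨z, MulOpposite.unop_injective hz⟩

theorem commute_centerEmbedding (z : Subring.center K) (a : EndRight K U) :
    Commute (centerEmbedding K U z) a :=
  MulOpposite.unop_injective (LinearMap.ext fun u => map_smul a.unop (z : K) u)

theorem standardChain_centerEmbedding_eq (hU : 1 < Module.rank K U) :
    standardChain (centerEmbedding K U) =
      relChain Distant (infPoint _) (affinePoint 0) (affinePoint 1) := by
  have : Nontrivial U := rank_pos_iff_nontrivial.1 (zero_lt_one.trans hU)
  ext p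
  rw [mem_standardChain_iff]
  constructor
  · rintro (rfl | ⟨z, rfl⟩)
    · exact Or.inl rfl
    refine affinePoint_mem_relChain_iff.2 ?_
    rcases eq_or_ne z 0 with rfl | hz
    · exact Or.inl (map_zero _)
    have hunit : IsUnit (centerEmbedding K U z) := hz.isUnit.map _
    refine Or.inr ⟨hunit, fun a ha ha1 => ?_⟩
    obtain ⟨b, hrange, hker, hb⟩ := exists_not_isUnit_sub_of_commute hunit.unop
      (commute_centerEmbedding z a).unop ha fun h => ha1 h.op
    exact ⟨.op b, hrange, hker, fun h => hb h.unop⟩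
  · intro hp
    refine or_iff_not_imp_left.2 fun hinf => ?_
    obtain ⟨f, rfl⟩ : ∃ f, p = affinePoint f := by
      rcases hp with h | h | h
      exacts [absurd h hinf, ⟨0, h⟩, distant_infPoint_iff.1 h.1]
    suffices ∃ z, f = centerEmbedding K U z from this.imp fun z hz => congrArg affinePoint hz
    rcases affinePoint_mem_relChain_iff.1 hp with rfl | ⟨hf, h⟩
    · exact ⟨0, (map_zero _).symm⟩
    refine exists_eq_centerEmbedding_of_forall_mem_span hU fun v => ?_
    by_contra hv
    obtain ⟨a, ha, ha1, hab⟩ := exists_isUnit_sub_of_notMem_span hf.unop hv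
    obtain ⟨b, hrange, hker, hb⟩ := h (.op a) ha fun h1 => ha1 h1.unop
    exact hb (hab b.unop hrange hker).op

end Chain

end ChainGeometry

/-- Let `K` be a division ring with centre `Z`, let `U` be a left vector space over `K` of finite
or infinite dimension greater than `1`, and let `R` be its endomorphism ring. The automorphisms of
the distant graph on the projective line over `R` are precisely the automorphisms of the chain
geometry `Σ(Z, R)`. -/
theorem corollary5p4 (K U : Type*) [DivisionRing K] [AddCommGroup U] [Module K U]
    (hU : 1 < Module.rank K U)
    (σ : Equiv.Perm (ChainGeometry.projLine (ChainGeometry.EndRight K U))) :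
    ChainGeometry.IsDistantAut σ ↔
      ChainGeometry.IsChainAut (ChainGeometry.centerEmbedding K U) σ := by
  have : Nontrivial U := rank_pos_iff_nontrivial.1 (zero_lt_one.trans hU)
  exact ⟨fun h => h.isChainAut (ChainGeometry.standardChain_centerEmbedding_eq hU),
    fun h => h.isDistantAut⟩
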